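/- Let $H$ be a random complex $m\times n$ matrix whose entries are independent, each with the zero-mean unit-variance circularly symmetric complex Gaussian distribution $\mathcal N_{\mathbb C}(0,1)$. For a deterministic matrix $A\in\mathbb C^{m\times n}$, a positive semidefinite Hermitian matrix $K\in\mathbb C^{n\times n}$ and $t\ge 0$, put $$F(t;K,A)=\Pr\bigl[\log\det\bigl(I_m+(H+A)K(H+A)^{\dagger}\bigr)\le t\bigr],\qquad \mathcal I(K,A)=\mathbb E\bigl[\log\det\bigl(I_m+(H+A)K(H+A)^{\dagger}\bigr)\bigr],$$ where $\dagger$ denotes the conjugate transpose. For $\mathcal E\ge 0$ and $R\ge 0$ define the isotropic Gaussian input information rate $\mathcal I^{\rm IG}(\mathcal E,A)=\mathcal I(\tfrac{\mathcal E}{n}I_n,A)$, the capacity $C(\mathcal E,A)=\max_K \mathcal I(K,A)$, the isotropic-input outage probability $P_{\rm out}^{\rm IG}(R,\mathcal E,A)=F(R;\tfrac{\mathcal E}{n}I_n,A)$ and the optimal outage probability $P_{\rm out}^{*}(R,\mathcal E,A)=\min_K F(R;K,A)$, where the maximum and the minimum are over all positive semidefinite $K\in\mathbb C^{n\times n}$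 with $\operatorname{tr}K\le\mathcal E$. (For every $A$, the expectations exist and are finite, and the maximum and the minimum are attained.) Let $D,\tilde D\in\mathbb C^{m\times n}$ have singular values $\sigma_1\ge\cdots\ge\sigma_{\min\{m,n\}}$ and $\tilde\sigma_1\ge\cdots\ge\tilde\sigma_{\min\{m,n\}}$, respectively, and suppose that $\sigma_i\ge\tilde\sigma_i$ for all $i$. Then, for all $\mathcal E\ge 0$ and $R\ge 0$, $$\mathcal I^{\rm IG}(\mathcal E,D)\ge \mathcal I^{\rm IG}(\mathcal E,\tilde D),\qquad C(\mathcal E,D)\ge C(\mathcal E,\tilde D),$$ $$P_{\rm out}^{\rm IG}(R,\mathcal E,D)\le P_{\rm out}^{\rm IG}(R,\mathcal E,\tilde D),\qquad P_{\rm out}^{*}(R,\mathcal E,D)\le P_{\rm out}^{*}(R,\mathcal E,\tilde D).$$ -/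

import Mathlib

open MeasureTheory ProbabilityTheory
open scoped ComplexOrder

noncomputable section

namespace RicianMIMO

/-- The zero-mean unit-variance circularly symmetric complex Gaussian law: the real and imaginary
parts are independent real Gaussians with mean `0` and variance `1 / 2`. -/
def stdComplexGaussian : Measure ℂ :=
  ((gaussianReal 0 (1 / 2)).prod (gaussianReal 0 (1 / 2))).map Complex.measurableEquivRealProd.symm

/-- `H` is a random `m × n` matrix with independent entries, each of them a zero-mean
unit-variance circularly symmetric complex Gaussian. -/
structure IsStdGaussianMatrix {Ω : Type*} [MeasurableSpace Ω] {m n : ℕ}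
    (H : Ω → Matrix (Fin m) (Fin n) ℂ) (P : Measure Ω) : Prop where
  hasLaw : ∀ i j, HasLaw (fun ω => H ω i j) stdComplexGaussian P
  indep : iIndepFun (fun (ij : Fin m × Fin n) ω => H ω ij.1 ij.2) P

/-- `log det (I + G K Gᴴ)`. For positive semidefinite `K` the determinant is a real number
greater than or equal to `1`. -/
def logDet {m n : ℕ} (K : Matrix (Fin n) (Fin n) ℂ) (G : Matrix (Fin m) (Fin n) ℂ) : ℝ :=
  Real.log (1 + G * K * G.conjTranspose).det.re

variable {Ω : Type*} [MeasurableSpace Ω] {m n : ℕ}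

/-- `F(t; K, D)`, the probability that `log det (I + (H + D) K (H + D)ᴴ) ≤ t`. -/
def outageProb (P : Measure Ω) (H : Ω → Matrix (Fin m) (Fin n) ℂ) (t : ℝ)
    (K : Matrix (Fin n) (Fin n) ℂ) (D : Matrix (Fin m) (Fin n) ℂ) : ℝ :=
  P.real {ω | logDet K (H ω + D) ≤ t}

/-- `I(K, D)`, the expectation of `log det (I + (H + D) K (H + D)ᴴ)`. -/
def infoRate (P : Measure Ω) (H : Ω → Matrix (Fin m) (Fin n) ℂ)
    (K : Matrix (Fin n) (Fin n) ℂ) (D : Matrix (Fin m) (Fin n) ℂ) : ℝ :=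
  ∫ ω, logDet K (H ω + D) ∂P

/-- The positive semidefinite matrices `K` with `tr K ≤ E`. -/
def inputCovariances (n : ℕ) (E : ℝ) : Set (Matrix (Fin n) (Fin n) ℂ) :=
  {K | K.PosSemidef ∧ K.trace.re ≤ E}

/-- The covariance matrix `(E / n) I` of the isotropic input of power `E`. -/
def isotropicCov (n : ℕ) (E : ℝ) : Matrix (Fin n) (Fin n) ℂ :=
  ((E / n : ℝ) : ℂ) • (1 : Matrix (Fin n) (Fin n) ℂ)

/-- The information rate of the isotropic Gaussian input of power `E`. -/
def isotropicInfoRate (P : Measure Ω) (H : Ω → Matrix (Fin m) (Fin n) ℂ) (E : ℝ)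
    (D : Matrix (Fin m) (Fin n) ℂ) : ℝ :=
  infoRate P H (isotropicCov n E) D

/-- The capacity under the trace constraint `E`. -/
def capacity (P : Measure Ω) (H : Ω → Matrix (Fin m) (Fin n) ℂ) (E : ℝ)
    (D : Matrix (Fin m) (Fin n) ℂ) : ℝ :=
  sSup ((fun K => infoRate P H K D) '' inputCovariances n E)

/-- The rate-`R` outage probability of the isotropic Gaussian input of power `E`. -/
def isotropicOutageProb (P : Measure Ω) (H : Ω → Matrix (Fin m) (Fin n) ℂ) (R E : ℝ)
    (D : Matrix (Fin m) (Fin n) ℂ) : ℝ :=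
  outageProb P H R (isotropicCov n E) D

/-- The optimal rate-`R` outage probability under the trace constraint `E`. -/
def optimalOutageProb (P : Measure Ω) (H : Ω → Matrix (Fin m) (Fin n) ℂ) (R E : ℝ)
    (D : Matrix (Fin m) (Fin n) ℂ) : ℝ :=
  sInf ((fun K => outageProb P H R K D) '' inputCovariances n E)

/-- The singular values of the matrix `D` in decreasing order; the largest has index `0`. -/
def singularValue (D : Matrix (Fin m) (Fin n) ℂ) (i : ℕ) : ℝ :=
  (Matrix.toEuclideanLin D).singularValues i

end RicianMIMO

end

open RicianMIMO

/-! The law of the Gaussian matrix is invariant under left and right unitary multiplication, so by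
the singular value decomposition each deterministic part may be taken rectangular diagonal, at the
cost of conjugating `K` by a unitary. Conjugation preserves the trace constraint and fixes the
isotropic covariance. Between the two diagonal matrices, each row is only rescaled by a factor of
larger or smaller modulus.

Fix all rows of `G` but one. Sylvester's identity and the matrix determinant lemma turn `det (1 + G
K Gᴴ)` into `δ (1 + y M yᴴ)` in the free row `y`, with `δ > 0` and `M` positive semidefinite
(`exists_re_det_updateRow`). The outage event is then a centred ellipsoid in that row, and
Anderson's inequality (`gaussianRow_quadForm_le_anti`) says that a longer shift along the same
direction lowers its probability. `Measure.pi_apply_mono` changes the rows one after another.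
Anderson's inequality is proved by the same device: diagonalising `M` makes the coordinates
independent, which leaves discs in the plane, then intervals under a symmetric unimodal density.

This compares the distribution functions at every level (`exists_unitary_logDet_le_anti`). Rates
follow by the layer cake formula, and the optimised quantities by transporting an optimal `K` for
`D'` to `W K Wᴴ` for `D`. Optimisers exist by compactness and dominated convergence; for the outage
probability, continuity rests on the absence of an atom at `R > 0`, and `R = 0` is treated apart. -/

namespace MeasureTheory.Measure

/-! ### Product measures compared factor by factor. -/

variable {ι : Type*} [Fintype ι]

lemma pi_map_curry {κ E : Type*} [Fintype κ] [MeasurableSpace E] (μ : Measure E)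
    [IsProbabilityMeasure μ] :
    (Measure.pi fun _ : ι × κ => μ).map Function.curry =
      Measure.pi fun _ : ι => Measure.pi fun _ : κ => μ := by
  have hm : Measurable (Function.curry : (ι × κ → E) → ι → κ → E) := by
    refine measurable_pi_lambda _ fun i => measurable_pi_lambda _ fun j => ?_
    exact measurable_pi_apply (i, j)
  have hu : Measurable (Function.uncurry : (ι → κ → E) → ι × κ → E) := by
    refine measurable_pi_lambda _ fun p => ?_
    exact (measurable_pi_apply p.2).comp (measurable_pi_apply p.1)
  have key : (Measure.pi fun _ : ι => Measure.pi fun _ : κ => μ).map Function.uncurry =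
      Measure.pi fun _ : ι × κ => μ := by
    refine (Measure.pi_eq fun s hs => ?_).symm
    rw [Measure.map_apply hu (MeasurableSet.univ_pi hs)]
    have : Function.uncurry ⁻¹' Set.univ.pi s =
        Set.univ.pi fun i => Set.univ.pi fun j => s (i, j) := by
      ext f
      simp [Function.uncurry]
    rw [this, Measure.pi_pi]
    simp_rw [Measure.pi_pi]
    rw [Fintype.prod_prod_type]
  rw [← key, Measure.map_map hm hu]
  exact Measure.map_id

variable [DecidableEq ι] {X : ι → Type*} [∀ i, MeasurableSpace (X i)]

/-- The measure of `S` under a product measure, computed by integrating the coordinate `i` first. -/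
lemma pi_apply_eq_lmarginal (μ : ∀ i, Measure (X i)) [∀ i, SigmaFinite (μ i)]
    {S : Set (∀ i, X i)} (hS : MeasurableSet S) (i : ι) (x : ∀ i, X i) :
    Measure.pi μ S =
      lmarginal μ (Finset.univ.erase i) (fun x => μ i {y | Function.update x i y ∈ S}) x := by
  rw [← lintegral_indicator_one hS, lintegral_eq_lmarginal_univ x,
    lmarginal_erase' _ (measurable_one.indicator hS) (Finset.mem_univ i)]
  congr 1
  ext z
  have hm : MeasurableSet {y | Function.update z i y ∈ S} := measurable_update z hS
  rw [← lintegral_indicator_one hm]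
  rfl

/-- A product measure decreases on `S` when one factor is replaced by a measure that is smaller
on every slice of `S`. -/
lemma pi_update_apply_le (μ : ∀ i, Measure (X i)) [∀ i, IsProbabilityMeasure (μ i)] (i : ι)
    (ν : Measure (X i)) [IsProbabilityMeasure ν] {S : Set (∀ i, X i)} (hS : MeasurableSet S)
    (h : ∀ x, ν {y | Function.update x i y ∈ S} ≤ μ i {y | Function.update x i y ∈ S}) :
    Measure.pi (Function.update μ i ν) S ≤ Measure.pi μ S := by
  have (j : ι) : IsProbabilityMeasure (Function.update μ i ν j) := by
    rcases eq_or_ne j i with rfl | hj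
    · simpa
    · simp only [Function.update_of_ne hj]; infer_instance
  have x : ∀ j, X j := fun j => (nonempty_of_isProbabilityMeasure (μ j)).some
  rw [pi_apply_eq_lmarginal _ hS i x, pi_apply_eq_lmarginal _ hS i x, Function.update_self]
  refine (lmarginal_mono (fun z => h z) x).trans_eq ?_
  have hp : (fun j : Finset.univ.erase i => Function.update μ i ν j) =
      fun j : Finset.univ.erase i => μ j := by
    funext j
    exact Function.update_of_ne (Finset.ne_of_mem_erase j.2) _ _
  simp only [lmarginal]
  rw [hp]

/-- Comparison of two product measures on a set `S`, factor by factor. -/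
lemma pi_apply_mono (μ ν : ∀ i, Measure (X i)) [∀ i, IsProbabilityMeasure (μ i)]
    [∀ i, IsProbabilityMeasure (ν i)] {S : Set (∀ i, X i)} (hS : MeasurableSet S)
    (h : ∀ i x, ν i {y | Function.update x i y ∈ S} ≤ μ i {y | Function.update x i y ∈ S}) :
    Measure.pi ν S ≤ Measure.pi μ S := by
  -- Hybrid argument: the factors are exchanged one at a time, through the products with `ν` on `s`
  -- and `μ` elsewhere.
  suffices H : ∀ s : Finset ι, Measure.pi (s.piecewise ν μ) S ≤ Measure.pi μ S by
    simpa using H Finset.univ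
  intro s
  induction s using Finset.induction_on with
  | empty => simp
  | insert i s hi ih =>
    have (j : ι) : IsProbabilityMeasure (s.piecewise ν μ j) := by
      by_cases hj : j ∈ s
      · rw [Finset.piecewise_eq_of_mem _ _ _ hj]; infer_instance
      · rw [Finset.piecewise_eq_of_notMem _ _ _ hj]; infer_instance
    rw [Finset.piecewise_insert]
    refine (pi_update_apply_le _ i (ν i) hS fun x => ?_).trans ih
    rw [Finset.piecewise_eq_of_notMem _ _ _ hi]
    exact h i x

lemma pi_apply_eq_zero_of_slices (μ : ∀ i, Measure (X i)) [∀ i, IsProbabilityMeasure (μ i)]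
    {S : Set (∀ i, X i)} (hS : MeasurableSet S) (i : ι)
    (h : ∀ x, μ i {y | Function.update x i y ∈ S} = 0) : Measure.pi μ S = 0 := by
  have x : ∀ j, X j := fun j => (nonempty_of_isProbabilityMeasure (μ j)).some
  rw [pi_apply_eq_lmarginal _ hS i x]
  simp [h, lmarginal]

end MeasureTheory.Measure

/-! ### Intervals under a real Gaussian. -/

namespace ProbabilityTheory

open scoped NNReal

lemma gaussianReal_sq_add_le_eq (v : ℝ≥0) (hv : v ≠ 0) (a r : ℝ) (hr : 0 ≤ r) :
    gaussianReal 0 v {x | (x + a) ^ 2 ≤ r} =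
      ENNReal.ofReal (∫ x in (|a| - √r)..(|a| + √r), gaussianPDFReal 0 v x) := by
  -- The symmetry `x ↦ -x` of the centred Gaussian makes the sign of the shift irrelevant.
  have hneg : gaussianReal 0 v {x | (x + a) ^ 2 ≤ r} = gaussianReal 0 v {x | (x - |a|) ^ 2 ≤ r} := by
    rcases le_total 0 a with ha | ha
    · have h := gaussianReal_map_neg (μ := 0) (v := v)
      rw [neg_zero] at h
      conv_lhs => rw [← h, Measure.map_apply measurable_neg
        (measurableSet_le (by fun_prop) (by fun_prop))]
      congr 1
      ext x
      simp only [Set.mem_preimage, Set.mem_ofPred_eq, abs_of_nonneg ha]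
      rw [show (-x + a) ^ 2 = (x - a) ^ 2 by ring]
    · simp_rw [abs_of_nonpos ha, sub_neg_eq_add]
  have hset : {x : ℝ | (x - |a|) ^ 2 ≤ r} = Set.Icc (|a| - √r) (|a| + √r) := by
    ext x
    simp only [Set.mem_ofPred_eq, Set.mem_Icc]
    rw [Real.sq_le hr]
    constructor <;> rintro ⟨h1, h2⟩ <;> constructor <;> linarith
  rw [hneg, hset, gaussianReal_apply_eq_integral _ hv, integral_Icc_eq_integral_Ioc,
    intervalIntegral.integral_of_le (by linarith [Real.sqrt_nonneg r])]

lemma continuous_gaussianPDFReal (μ : ℝ) (v : ℝ≥0) : Continuous (gaussianPDFReal μ v) := by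
  unfold gaussianPDFReal
  fun_prop

/-- A centred Gaussian puts less mass on an interval of given length when its centre moves away
from the origin. -/
lemma gaussianReal_sq_add_le_anti (v : ℝ≥0) (hv : v ≠ 0) {a b : ℝ} (hab : |a| ≤ |b|) (r : ℝ) :
    gaussianReal 0 v {x | (x + b) ^ 2 ≤ r} ≤ gaussianReal 0 v {x | (x + a) ^ 2 ≤ r} := by
  rcases lt_or_ge r 0 with hr | hr
  · have : {x : ℝ | (x + b) ^ 2 ≤ r} = ∅ := by
      ext x
      simp only [Set.mem_ofPred_eq, Set.mem_empty_iff_false, iff_false, not_le]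
      exact hr.trans_le (sq_nonneg _)
    simp [this]
  rw [gaussianReal_sq_add_le_eq v hv a r hr, gaussianReal_sq_add_le_eq v hv b r hr]
  refine ENNReal.ofReal_le_ofReal ?_
  set φ := gaussianPDFReal 0 v with hφ
  have hc : Continuous φ := continuous_gaussianPDFReal 0 v
  have hi (x y : ℝ) : IntervalIntegrable φ volume x y := hc.intervalIntegrable x y
  have hd (c : ℝ) : HasDerivAt (fun c => ∫ x in (c - √r)..(c + √r), φ x)
      (φ (c + √r) - φ (c - √r)) c := by
    have hF (u : ℝ) : HasDerivAt (fun u => ∫ x in (0 : ℝ)..u, φ x) (φ u) u :=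
      intervalIntegral.integral_hasDerivAt_right (hi _ _) (hc.stronglyMeasurableAtFilter _ _)
        hc.continuousAt
    have h := ((hF (c + √r)).comp_add_const c (√r)).sub ((hF (c - √r)).comp_sub_const c (√r))
    refine h.congr_of_eventuallyEq (Filter.Eventually.of_forall fun c => ?_)
    simp only [Pi.sub_apply]
    rw [intervalIntegral.integral_interval_sub_left (hi _ _) (hi _ _)]
  have hanti : AntitoneOn (fun c => ∫ x in (c - √r)..(c + √r), φ x) (Set.Ici 0) := by
    refine antitoneOn_of_deriv_nonpos (convex_Ici 0)
      (fun c _ => (hd c).continuousAt.continuousWithinAt)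
      (fun c _ => (hd c).differentiableAt.differentiableWithinAt) fun c hcm => ?_
    rw [interior_Ici] at hcm
    rw [(hd c).deriv, sub_nonpos, hφ]
    unfold gaussianPDFReal
    have hcm : 0 < c := hcm
    have := Real.sqrt_nonneg r
    gcongr ?_ * Real.exp (?_ / _)
    -- The derivative in the centre `c` is a difference of densities at `c + √r` and `c - √r`; for
    -- `c > 0` the former point is at least as far from the origin, because `c * √r ≥ 0`.
    nlinarith
  exact hanti (abs_nonneg a) (abs_nonneg b) hab

end ProbabilityTheory

/-! ### The standard complex Gaussian: discs, circles, unitary invariance. -/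

namespace RicianMIMO

instance : IsProbabilityMeasure stdComplexGaussian :=
  Measure.isProbabilityMeasure_map Complex.measurableEquivRealProd.symm.measurable.aemeasurable

lemma stdComplexGaussian_apply {S : Set ℂ} (hS : MeasurableSet S) :
    stdComplexGaussian S = ((gaussianReal 0 (1 / 2)).prod (gaussianReal 0 (1 / 2)))
      {p | (⟨p.1, p.2⟩ : ℂ) ∈ S} := by
  rw [stdComplexGaussian, Measure.map_apply (MeasurableEquiv.measurable _) hS]
  rfl

/-- The mass that a complex Gaussian puts on a disc decreases as its centre moves away from the
origin along a ray. -/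
lemma stdComplexGaussian_normSq_add_le_anti {s t : ℝ} (hst : |s| ≤ |t|) (d : ℂ) (r : ℝ) :
    stdComplexGaussian {z | Complex.normSq (z + t * d) ≤ r} ≤
      stdComplexGaussian {z | Complex.normSq (z + s * d) ≤ r} := by
  have hm (u : ℝ) : MeasurableSet {z : ℂ | Complex.normSq (z + u * d) ≤ r} :=
    measurableSet_le (Complex.continuous_normSq.measurable.comp (by fun_prop)) measurable_const
  have hmem (u x y : ℝ) : (⟨x, y⟩ : ℂ) ∈ {z : ℂ | Complex.normSq (z + u * d) ≤ r} ↔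
      (x + u * d.re) ^ 2 + (y + u * d.im) ^ 2 ≤ r := by
    simp [Complex.normSq_apply, sq]
  have hm2 (u v : ℝ) : MeasurableSet
      {p : ℝ × ℝ | (p.1 + u * d.re) ^ 2 + (p.2 + v * d.im) ^ 2 ≤ r} :=
    measurableSet_le (by fun_prop) (by fun_prop)
  have hle (c : ℝ) : |s * c| ≤ |t * c| := by
    rw [abs_mul, abs_mul]; gcongr
  have hv : (1 / 2 : NNReal) ≠ 0 := by norm_num
  rw [stdComplexGaussian_apply (hm t), stdComplexGaussian_apply (hm s)]
  simp_rw [hmem]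
  set g := gaussianReal 0 (1 / 2)
  -- The two real shifts are changed separately, the imaginary one first; each slice of the disc is
  -- an interval, possibly empty.
  calc (g.prod g) {p : ℝ × ℝ | (p.1 + t * d.re) ^ 2 + (p.2 + t * d.im) ^ 2 ≤ r}
      ≤ (g.prod g) {p : ℝ × ℝ | (p.1 + t * d.re) ^ 2 + (p.2 + s * d.im) ^ 2 ≤ r} := by
        rw [Measure.prod_apply (hm2 t t), Measure.prod_apply (hm2 t s)]
        refine lintegral_mono fun x => ?_
        simpa only [Set.preimage_ofPred_eq, ← le_sub_iff_add_le'] using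
          gaussianReal_sq_add_le_anti _ hv (hle d.im) (r - (x + t * d.re) ^ 2)
    _ ≤ (g.prod g) {p : ℝ × ℝ | (p.1 + s * d.re) ^ 2 + (p.2 + s * d.im) ^ 2 ≤ r} := by
        rw [Measure.prod_apply_symm (hm2 t s), Measure.prod_apply_symm (hm2 s s)]
        refine lintegral_mono fun y => ?_
        simpa only [Set.preimage_ofPred_eq, ← le_sub_iff_add_le] using
          gaussianReal_sq_add_le_anti _ hv (hle d.re) (r - (y + s * d.im) ^ 2)

/-- Every vertical line meets the circle in at most two points, and a nondegenerate real Gaussian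
has no atoms. -/
lemma stdComplexGaussian_normSq_add_eq (d : ℂ) (r : ℝ) :
    stdComplexGaussian {z | Complex.normSq (z + d) = r} = 0 := by
  have hm : MeasurableSet {z : ℂ | Complex.normSq (z + d) = r} :=
    measurableSet_eq_fun (Complex.continuous_normSq.measurable.comp (by fun_prop)) measurable_const
  have := nullSingletonClass_gaussianReal (μ := 0) (v := 1 / 2) (by norm_num)
  have hm2 : MeasurableSet
      {p : ℝ × ℝ | (p.1 + d.re) ^ 2 + (p.2 + d.im) ^ 2 = r} :=
    measurableSet_eq_fun (by fun_prop) (by fun_prop)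
  rw [stdComplexGaussian_apply hm]
  have hset : {p : ℝ × ℝ | (⟨p.1, p.2⟩ : ℂ) ∈ {z : ℂ | Complex.normSq (z + d) = r}} =
      {p : ℝ × ℝ | (p.1 + d.re) ^ 2 + (p.2 + d.im) ^ 2 = r} := by
    ext p
    simp [Complex.normSq_apply, sq]
  rw [hset, Measure.measure_prod_null hm2]
  refine Filter.Eventually.of_forall fun x => ?_
  refine Set.Finite.measure_zero (s := _) ?_ _
  refine Set.Finite.subset (Set.toFinite {√(r - (x + d.re) ^ 2) - d.im, -√(r - (x + d.re) ^ 2) - d.im})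
    fun y hy => ?_
  have hy : (x + d.re) ^ 2 + (y + d.im) ^ 2 = r := hy
  have h2 : (y + d.im) ^ 2 = √(r - (x + d.re) ^ 2) ^ 2 := by
    rw [Real.sq_sqrt] <;> nlinarith [sq_nonneg (y + d.im)]
  rcases sq_eq_sq_iff_eq_or_eq_neg.1 h2 with h | h
  · left; linarith
  · right; simp only [Set.mem_singleton_iff]; linarith

/-- The value depends on `t` through `‖t‖` alone, which is what makes vectors of independent copies
unitarily invariant. -/
lemma charFun_stdComplexGaussian (t : ℂ) :
    charFun stdComplexGaussian t = Complex.exp (-(‖t‖ ^ 2 / 4 : ℝ)) := by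
  have h1 : charFun stdComplexGaussian t =
      charFun (gaussianReal 0 (1 / 2)) t.re * charFun (gaussianReal 0 (1 / 2)) t.im := by
    rw [charFun_apply, charFun_apply, charFun_apply, stdComplexGaussian,
      integral_map_equiv]
    rw [← integral_prod_mul]
    congr 1
    ext p
    rw [← Complex.exp_add, ← add_mul, ← Complex.ofReal_add]
    congr 3
    simp [Complex.inner, Complex.measurableEquivRealProd]
  rw [h1, charFun_gaussianReal, charFun_gaussianReal, ← Complex.exp_add]
  congr 1
  rw [Complex.sq_norm, Complex.normSq_apply]
  push_cast
  ring

/-- The law of a vector of independent standard complex Gaussians is invariant under unitary maps. -/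
lemma pi_stdComplexGaussian_map {ι : Type*} [Fintype ι] (f : (ι → ℂ) →ₗ[ℂ] (ι → ℂ))
    (hf : ∀ x, ∑ i, ‖f x i‖ ^ 2 = ∑ i, ‖x i‖ ^ 2) :
    (Measure.pi fun _ : ι => stdComplexGaussian).map f =
      Measure.pi fun _ : ι => stdComplexGaussian := by
  let V := PiLp 2 fun _ : ι => ℂ
  let μ : Measure V := (Measure.pi fun _ : ι => stdComplexGaussian).map (WithLp.toLp 2)
  have hfm : Measurable f := (LinearMap.continuous_of_finiteDimensional f).measurable
  -- Characteristic functions need an inner product, so `f` is transported to the Euclidean space,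
  -- where it is a real linear isometry and, by equality of dimensions, invertible.
  let L : V →ₗᵢ[ℝ] V :=
    { toLinearMap := ((WithLp.linearEquiv 2 ℝ (ι → ℂ)).symm.toLinearMap ∘ₗ
        f.restrictScalars ℝ ∘ₗ (WithLp.linearEquiv 2 ℝ (ι → ℂ)).toLinearMap)
      norm_map' := fun x => by
        rw [PiLp.norm_eq_of_L2, PiLp.norm_eq_of_L2]
        congr 1
        exact hf x.ofLp }
  let e : V ≃ₗᵢ[ℝ] V := L.toLinearIsometryEquiv rfl
  have hμ : μ.map e = μ := by
    have : IsProbabilityMeasure μ := Measure.isProbabilityMeasure_map (by fun_prop)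
    have : IsProbabilityMeasure (μ.map e) :=
      Measure.isProbabilityMeasure_map e.continuous.measurable.aemeasurable
    have hval (t : V) : charFun μ t = Complex.exp (-(‖t‖ ^ 2 / 4 : ℝ)) := by
      rw [charFun_pi]
      simp_rw [charFun_stdComplexGaussian]
      rw [← Complex.exp_sum, PiLp.norm_sq_eq_of_L2]
      congr 1
      push_cast
      rw [Finset.sum_neg_distrib, Finset.sum_div]
    refine Measure.ext_of_charFun ?_
    ext t
    rw [hval, ← e.symm.norm_map t, ← hval, charFun_apply, charFun_apply,
      integral_map e.continuous.measurable.aemeasurable (by fun_prop)]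
    simp_rw [← e.inner_map_eq_flip]
  have hofLp : μ.map WithLp.ofLp = Measure.pi fun _ : ι => stdComplexGaussian := by
    rw [Measure.map_map (by fun_prop) (by fun_prop)]
    exact Measure.map_id
  have hcomp : (f : (ι → ℂ) → ι → ℂ) ∘ (WithLp.ofLp : V → ι → ℂ) = WithLp.ofLp ∘ e := rfl
  rw [← hofLp, Measure.map_map hfm (by fun_prop), hcomp,
    ← Measure.map_map (by fun_prop) e.continuous.measurable, hμ]

lemma integrable_normSq_stdComplexGaussian :
    Integrable (fun z : ℂ => ‖z‖ ^ 2) stdComplexGaussian := by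
  rw [stdComplexGaussian, MeasurableEmbedding.integrable_map_iff (MeasurableEquiv.measurableEmbedding _)]
  have h : Integrable (fun x : ℝ => x ^ 2) (gaussianReal 0 (1 / 2)) :=
    (memLp_id_gaussianReal 2).integrable_sq
  refine ((h.comp_fst (gaussianReal 0 (1 / 2))).add (h.comp_snd (gaussianReal 0 (1 / 2)))).congr
    (Filter.Eventually.of_forall fun p => ?_)
  rw [Function.comp_apply, Complex.sq_norm, Complex.normSq_apply]
  simp [Complex.measurableEquivRealProd, sq]

end RicianMIMO

/-! ### Hermitian forms of a Gaussian row. -/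

namespace RicianMIMO

open Matrix

variable {ι : Type*} [Fintype ι] [DecidableEq ι]

lemma dotProduct_mulVec_star_eq_sum {M : Matrix ι ι ℂ} (hM : M.IsHermitian) (y : ι → ℂ) :
    (y ⬝ᵥ (M *ᵥ star y)).re = ∑ j, hM.eigenvalues j *
      Complex.normSq ((y ᵥ* (hM.eigenvectorUnitary : Matrix ι ι ℂ)) j) := by
  set W := (hM.eigenvectorUnitary : Matrix ι ι ℂ)
  have h : M = W * Matrix.diagonal (RCLike.ofReal ∘ hM.eigenvalues) * Wᴴ := by
    conv_lhs => rw [hM.spectral_theorem]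
    rfl
  have h2 : y ⬝ᵥ (M *ᵥ star y) = (y ᵥ* W) ⬝ᵥ
      (Matrix.diagonal (RCLike.ofReal ∘ hM.eigenvalues) *ᵥ star (y ᵥ* W)) := by
    conv_lhs => rw [h]
    rw [← Matrix.mulVec_mulVec, ← Matrix.mulVec_mulVec, Matrix.dotProduct_mulVec, star_vecMul]
  rw [h2, dotProduct, Complex.re_sum]
  refine Finset.sum_congr rfl fun j _ => ?_
  rw [Matrix.mulVec_diagonal, Complex.normSq_apply]
  simp
  ring

lemma sum_norm_vecMul_sq_of_mem_unitaryGroup {W : Matrix ι ι ℂ}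
    (hW : W ∈ Matrix.unitaryGroup ι ℂ) (x : ι → ℂ) :
    ∑ i, ‖(x ᵥ* W) i‖ ^ 2 = ∑ i, ‖x i‖ ^ 2 := by
  have key (z : ι → ℂ) : ((∑ i, ‖z i‖ ^ 2 : ℝ) : ℂ) = z ⬝ᵥ star z := by
    simp [dotProduct, Complex.mul_conj, Complex.normSq_eq_norm_sq]
  apply Complex.ofReal_injective
  rw [key, key, ← Matrix.dotProduct_mulVec, star_vecMul, Matrix.mulVec_mulVec,
    ← Matrix.star_eq_conjTranspose, Matrix.mem_unitaryGroup_iff.1 hW, Matrix.one_mulVec]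

/-- The law of a row of the channel matrix. -/
noncomputable abbrev gaussianRow (ι : Type*) [Fintype ι] : Measure (ι → ℂ) :=
  Measure.pi fun _ => stdComplexGaussian

lemma gaussianRow_map_vecMul {W : Matrix ι ι ℂ} (hW : W ∈ Matrix.unitaryGroup ι ℂ) :
    (gaussianRow ι).map (fun x => x ᵥ* W) = gaussianRow ι :=
  pi_stdComplexGaussian_map (Matrix.vecMulLinear W)
    (sum_norm_vecMul_sq_of_mem_unitaryGroup hW)

/-- In the eigenbasis of `M` the shifted quadratic form has independent coordinates. -/
lemma gaussianRow_quadForm_mem {M : Matrix ι ι ℂ} (hM : M.IsHermitian) (a : ι → ℂ) {T : Set ℝ}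
    (hT : MeasurableSet T) :
    gaussianRow ι {x | ((x + a) ⬝ᵥ (M *ᵥ star (x + a))).re ∈ T} =
      Measure.pi (fun j => stdComplexGaussian.map
        (· + (a ᵥ* (hM.eigenvectorUnitary : Matrix ι ι ℂ)) j))
        {z | ∑ j, hM.eigenvalues j * Complex.normSq (z j) ∈ T} := by
  set W := (hM.eigenvectorUnitary : Matrix ι ι ℂ)
  have hm : MeasurableSet {z : ι → ℂ | ∑ j, hM.eigenvalues j * Complex.normSq (z j) ∈ T} := by
    refine Measurable.setOf (p := fun z : ι → ℂ => _ ∈ T) ?_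
    exact (Measurable.comp (g := (· ∈ T)) hT.mem (Finset.measurable_sum _ fun j _ =>
      (Complex.continuous_normSq.measurable.comp (measurable_pi_apply j)).const_mul _))
  have (j : ι) : IsProbabilityMeasure (stdComplexGaussian.map (· + (a ᵥ* W) j)) :=
    Measure.isProbabilityMeasure_map (by fun_prop)
  rw [← Measure.pi_map_pi (fun j => by fun_prop), Measure.map_apply (by fun_prop) hm]
  conv_rhs => rw [show (Measure.pi fun _ : ι => stdComplexGaussian) = gaussianRow ι from rfl,
    ← gaussianRow_map_vecMul hM.eigenvectorUnitary.2]
  rw [Measure.map_apply (by fun_prop : Measurable fun x : ι → ℂ => x ᵥ* W) ((by fun_prop : Measurable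
    fun (x : ι → ℂ) j => x j + (a ᵥ* W) j) hm)]
  congr 1
  ext x
  simp only [Set.mem_ofPred_eq, Set.mem_preimage, dotProduct_mulVec_star_eq_sum hM, W,
    Matrix.add_vecMul, Pi.add_apply]

/-- Anderson's inequality for ellipsoids: scaling up the shift of a Gaussian vector decreases the
probability of a centred ellipsoid. -/
lemma gaussianRow_quadForm_le_anti {M : Matrix ι ι ℂ} (hM : M.PosSemidef) (v : ι → ℂ) {s t : ℝ}
    (hst : |s| ≤ |t|) (c : ℝ) :
    gaussianRow ι {x | ((x + (t : ℂ) • v) ⬝ᵥ (M *ᵥ star (x + (t : ℂ) • v))).re ≤ c} ≤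
      gaussianRow ι {x | ((x + (s : ℂ) • v) ⬝ᵥ (M *ᵥ star (x + (s : ℂ) • v))).re ≤ c} := by
  have h1 := gaussianRow_quadForm_mem hM.1 ((t : ℂ) • v) (measurableSet_Iic (a := c))
  have h2 := gaussianRow_quadForm_mem hM.1 ((s : ℂ) • v) (measurableSet_Iic (a := c))
  simp only [Set.mem_Iic] at h1 h2
  rw [h1, h2]
  set W := (hM.1.eigenvectorUnitary : Matrix ι ι ℂ)
  have hp (a : ℂ) : IsProbabilityMeasure (stdComplexGaussian.map (· + a)) :=
    Measure.isProbabilityMeasure_map (by fun_prop)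
  have hn : Measurable Complex.normSq := Complex.continuous_normSq.measurable
  refine Measure.pi_apply_mono _ _ (measurableSet_le (by fun_prop) measurable_const) fun j x => ?_
  have hset : {y : ℂ | Function.update x j y ∈
      {z : ι → ℂ | ∑ j, hM.1.eigenvalues j * Complex.normSq (z j) ≤ c}} =
      {y : ℂ | hM.1.eigenvalues j * Complex.normSq y ≤
        c - ∑ k ∈ Finset.univ.erase j, hM.1.eigenvalues k * Complex.normSq (x k)} := by
    ext y
    simp only [Set.mem_ofPred_eq]
    rw [← Finset.add_sum_erase _ _ (Finset.mem_univ j), Function.update_self,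
      Finset.sum_congr rfl fun k hk => by
        rw [Function.update_of_ne (Finset.ne_of_mem_erase hk)], le_sub_iff_add_le]
  rw [hset]
  generalize c - ∑ k ∈ Finset.univ.erase j, hM.1.eigenvalues k * Complex.normSq (x k) = r
  rcases (hM.eigenvalues_nonneg j).eq_or_lt with h0 | h0
  -- For a zero eigenvalue the slice is everything or empty according to the sign of `r`, whatever
  -- the shift.
  · rw [← h0]
    by_cases hr : 0 ≤ r <;> simp [hr]
  · have hm : MeasurableSet {y : ℂ | hM.1.eigenvalues j * Complex.normSq y ≤ r} :=
      measurableSet_le (by fun_prop) measurable_const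
    rw [Measure.map_apply (by fun_prop) hm, Measure.map_apply (by fun_prop) hm]
    simp only [Set.preimage_ofPred_eq, ← le_div_iff₀' h0, Matrix.smul_vecMul, Pi.smul_apply,
      smul_eq_mul]
    exact stdComplexGaussian_normSq_add_le_anti hst _ _

/-- A nonzero quadratic form of a Gaussian vector has no atoms. -/
lemma gaussianRow_quadForm_eq {M : Matrix ι ι ℂ} (hM : M.IsHermitian) (hM0 : M ≠ 0) (a : ι → ℂ)
    (c : ℝ) : gaussianRow ι {x | ((x + a) ⬝ᵥ (M *ᵥ star (x + a))).re = c} = 0 := by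
  have h1 := gaussianRow_quadForm_mem hM a (measurableSet_singleton c)
  simp only [Set.mem_singleton_iff] at h1
  rw [h1]
  have hp (a : ℂ) : IsProbabilityMeasure (stdComplexGaussian.map (· + a)) :=
    Measure.isProbabilityMeasure_map (by fun_prop)
  have hn : Measurable Complex.normSq := Complex.continuous_normSq.measurable
  obtain ⟨j, hj⟩ : ∃ j, hM.eigenvalues j ≠ 0 := by
    by_contra! h
    exact hM0 (hM.eigenvalues_eq_zero_iff.1 (funext h))
  refine Measure.pi_apply_eq_zero_of_slices _
    (measurableSet_eq_fun (by fun_prop) measurable_const) j fun x => ?_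
  have hset : {y : ℂ | Function.update x j y ∈
      {z : ι → ℂ | ∑ j, hM.eigenvalues j * Complex.normSq (z j) = c}} =
      {y : ℂ | Complex.normSq y = (c - ∑ k ∈ Finset.univ.erase j,
        hM.eigenvalues k * Complex.normSq (x k)) / hM.eigenvalues j} := by
    ext y
    simp only [Set.mem_ofPred_eq]
    rw [← Finset.add_sum_erase _ _ (Finset.mem_univ j), Function.update_self,
      Finset.sum_congr rfl fun k hk => by
        rw [Function.update_of_ne (Finset.ne_of_mem_erase hk)], eq_div_iff hj, eq_sub_iff_add_eq,
      mul_comm]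
  rw [hset, Measure.map_apply (by fun_prop) (measurableSet_eq_fun (by fun_prop) measurable_const)]
  exact stdComplexGaussian_normSq_add_eq _ _

end RicianMIMO

/-! ### The determinant as a function of one row. -/

namespace RicianMIMO

open Matrix

section Determinant

variable {ι κ : Type*} [Fintype ι] [DecidableEq ι] [Fintype κ] [DecidableEq κ]

lemma det_one_add_eq_prod {P : Matrix ι ι ℂ} (hP : P.IsHermitian) :
    (1 + P).det = ((∏ i, (1 + hP.eigenvalues i) : ℝ) : ℂ) := by
  set W := (hP.eigenvectorUnitary : Matrix ι ι ℂ)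
  have hW : W * star W = 1 := Matrix.mem_unitaryGroup_iff.1 hP.eigenvectorUnitary.2
  have h : 1 + P = W * Matrix.diagonal (fun i => 1 + (hP.eigenvalues i : ℂ)) * star W := by
    have h1 : P = W * Matrix.diagonal (RCLike.ofReal ∘ hP.eigenvalues) * star W := by
      conv_lhs => rw [hP.spectral_theorem]
      rfl
    have h2 : Matrix.diagonal (fun i => 1 + (hP.eigenvalues i : ℂ)) =
        1 + Matrix.diagonal (RCLike.ofReal ∘ hP.eigenvalues) := by
      rw [← Matrix.diagonal_one, Matrix.diagonal_add]
      rfl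
    rw [h2, mul_add, add_mul, mul_one, hW, ← h1]
  rw [h, Matrix.det_mul_right_comm, hW, one_mul, Matrix.det_diagonal]
  push_cast
  rfl

lemma one_le_re_det_one_add {P : Matrix ι ι ℂ} (hP : P.PosSemidef) : 1 ≤ (1 + P).det.re := by
  rw [det_one_add_eq_prod hP.1, Complex.ofReal_re]
  exact Finset.one_le_prod fun i _ => by linarith [hP.eigenvalues_nonneg i]

/-- Apply `1 + x ≤ exp x` to each eigenvalue. It supplies the integrable majorant of `logDet`. -/
lemma log_re_det_one_add_le_trace {P : Matrix ι ι ℂ} (hP : P.PosSemidef) :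
    Real.log (1 + P).det.re ≤ P.trace.re := by
  rw [Real.log_le_iff_le_exp (by linarith [one_le_re_det_one_add hP]),
    det_one_add_eq_prod hP.1, Complex.ofReal_re, hP.1.trace_eq_sum_eigenvalues, Complex.re_sum,
    Real.exp_sum]
  refine Finset.prod_le_prod (fun i _ => by linarith [hP.eigenvalues_nonneg i]) fun i _ => ?_
  rw [add_comm]
  exact Real.add_one_le_exp _

lemma conjTranspose_mul_self_updateRow {ι κ : Type*} [Fintype ι] [DecidableEq ι] (A : Matrix ι κ ℂ) (i : ι) (v : κ → ℂ) :
    (A.updateRow i v)ᴴ * A.updateRow i v = (A.updateRow i 0)ᴴ * A.updateRow i 0 +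
      replicateCol Unit (star v) * replicateRow Unit v := by
  ext a b
  simp only [Matrix.mul_apply, Matrix.add_apply, Matrix.conjTranspose_apply]
  have h (w : κ → ℂ) : ∑ k, star (A.updateRow i w k a) * A.updateRow i w k b =
      star (w a) * w b + ∑ k ∈ Finset.univ.erase i, star (A k a) * A k b := by
    rw [← Finset.add_sum_erase _ _ (Finset.mem_univ i), Matrix.updateRow_self,
      Finset.sum_congr rfl fun k hk => by
        rw [Matrix.updateRow_ne (Finset.ne_of_mem_erase hk)]]
  rw [h, h]
  simp [add_comm]

lemma updateRow_mul_eq {ι κ : Type*} [DecidableEq ι] [Fintype κ] (A : Matrix ι κ ℂ)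
    (B : Matrix κ κ ℂ) (i : ι) (v : κ → ℂ) :
    A.updateRow i v * B = (A * B).updateRow i (v ᵥ* B) := by
  ext k l
  rcases eq_or_ne k i with rfl | hk
  · simp [Matrix.mul_apply, Matrix.vecMul, dotProduct]
  · simp [Matrix.mul_apply, Matrix.updateRow_ne hk]

open scoped MatrixOrder in
/-- As a function of one row of `G`, the determinant of `1 + G K Gᴴ` is an affine function of a
positive semidefinite quadratic form. -/
lemma exists_re_det_updateRow {K : Matrix κ κ ℂ} (hK : K.PosSemidef) (G : Matrix ι κ ℂ) (i : ι) :
    ∃ δ : ℝ, 0 < δ ∧ ∃ M : Matrix κ κ ℂ, M.PosSemidef ∧ (K ≠ 0 → M ≠ 0) ∧ ∀ y : κ → ℂ,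
      (1 + G.updateRow i y * K * (G.updateRow i y)ᴴ).det.re =
        δ * (1 + (y ⬝ᵥ (M *ᵥ star y)).re) := by
  obtain ⟨B, hB⟩ : ∃ B : Matrix κ κ ℂ, K = B * Bᴴ := by
    obtain ⟨B, hB⟩ := CStarAlgebra.nonneg_iff_eq_star_mul_self.1 hK.nonneg
    exact ⟨Bᴴ, by rw [Matrix.conjTranspose_conjTranspose]; exact hB⟩
  -- With `K = B Bᴴ`, Sylvester's identity passes to the Gram matrix of `G B`, in which row `i`
  -- contributes a rank-one term; `S` collects the rest and does not involve `y`.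
  set S : Matrix κ κ ℂ := 1 + ((G * B).updateRow i 0)ᴴ * (G * B).updateRow i 0 with hS
  have hSpos : S.PosDef := Matrix.PosDef.one.add_posSemidef (posSemidef_conjTranspose_mul_self _)
  have hdet := (Complex.pos_iff.1 hSpos.det_pos)
  refine ⟨S.det.re, hdet.1, B * S⁻¹ * Bᴴ, hSpos.inv.posSemidef.mul_mul_conjTranspose_same B,
    fun hK0 hM => hK0 ?_, fun y => ?_⟩
  -- Since `S⁻¹` is positive definite, `B S⁻¹ Bᴴ = 0` forces `Bᴴ` to kill every basis vector.
  · have hBz : Bᴴ = 0 := by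
      refine Matrix.ext_of_mulVec_single fun j => ?_
      set z := Bᴴ *ᵥ Pi.single j 1 with hz
      rw [Matrix.zero_mulVec]
      by_contra hne
      have hpos := hSpos.inv.dotProduct_mulVec_pos hne
      have hzero : star z ⬝ᵥ (S⁻¹ *ᵥ z) = 0 := by
        rw [hz, star_mulVec, Matrix.conjTranspose_conjTranspose, ← Matrix.dotProduct_mulVec,
          Matrix.mulVec_mulVec, Matrix.mulVec_mulVec, hM, Matrix.zero_mulVec,
          dotProduct_zero]
      exact hpos.ne' hzero
    rw [hB, hBz, Matrix.mul_zero]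
  · have h1 : G.updateRow i y * K * (G.updateRow i y)ᴴ =
        (G * B).updateRow i (y ᵥ* B) * ((G * B).updateRow i (y ᵥ* B))ᴴ := by
      rw [← updateRow_mul_eq, hB, Matrix.conjTranspose_mul]
      simp only [Matrix.mul_assoc]
    rw [h1, Matrix.det_one_add_mul_comm, conjTranspose_mul_self_updateRow, ← add_assoc, ← hS,
      Matrix.det_add_replicateCol_mul_replicateRow ((Matrix.isUnit_iff_isUnit_det _).1 hSpos.isUnit)]
    have h2 : (1 + replicateRow Unit (y ᵥ* B) * S⁻¹ * replicateCol Unit (star (y ᵥ* B))).det =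
        1 + y ⬝ᵥ ((B * S⁻¹ * Bᴴ) *ᵥ star y) := by
      rw [Matrix.det_unique, Matrix.add_apply, Matrix.one_apply_eq, ← Matrix.mulVec_mulVec,
        ← Matrix.mulVec_mulVec, Matrix.dotProduct_mulVec, star_vecMul, Matrix.mul_assoc]
      rfl
    rw [h2, Complex.mul_re, ← hdet.2]
    simp

end Determinant

/-! ### Row-by-row comparison of outage probabilities. -/

section LogDet

variable {m n : ℕ} {K : Matrix (Fin n) (Fin n) ℂ}

lemma one_le_re_det (hK : K.PosSemidef) (G : Matrix (Fin m) (Fin n) ℂ) :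
    1 ≤ (1 + G * K * Gᴴ).det.re :=
  one_le_re_det_one_add (hK.mul_mul_conjTranspose_same G)

lemma logDet_nonneg (hK : K.PosSemidef) (G : Matrix (Fin m) (Fin n) ℂ) : 0 ≤ logDet K G :=
  Real.log_nonneg (one_le_re_det hK G)

lemma logDet_le_iff (hK : K.PosSemidef) (G : Matrix (Fin m) (Fin n) ℂ) (c : ℝ) :
    logDet K G ≤ c ↔ (1 + G * K * Gᴴ).det.re ≤ Real.exp c :=
  Real.log_le_iff_le_exp (by linarith [one_le_re_det hK G])

lemma logDet_eq_iff (hK : K.PosSemidef) (G : Matrix (Fin m) (Fin n) ℂ) (c : ℝ) :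
    logDet K G = c ↔ (1 + G * K * Gᴴ).det.re = Real.exp c := by
  have h : 0 < (1 + G * K * Gᴴ).det.re := by linarith [one_le_re_det hK G]
  constructor
  · rintro rfl
    exact (Real.exp_log h).symm
  · intro h2
    rw [logDet, h2, Real.log_exp]

lemma measurable_logDet (K : Matrix (Fin n) (Fin n) ℂ) :
    Measurable fun G : Fin m → Fin n → ℂ => logDet K (of G) := by
  refine Real.measurable_log.comp (Continuous.measurable ?_)
  have : Continuous fun G : Fin m → Fin n → ℂ => (of G : Matrix (Fin m) (Fin n) ℂ) :=
    continuous_id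
  fun_prop

/-- The law of the channel matrix, row by row. -/
noncomputable abbrev gaussianMatrix (m n : ℕ) : Measure (Fin m → Fin n → ℂ) :=
  Measure.pi fun _ => gaussianRow (Fin n)

lemma gaussianMatrix_add_preimage (A : Fin m → Fin n → ℂ) {T : Set (Fin m → Fin n → ℂ)}
    (hT : MeasurableSet T) : gaussianMatrix m n ((· + A) ⁻¹' T) =
      Measure.pi (fun i => (gaussianRow (Fin n)).map (· + A i)) T := by
  have (i : Fin m) : IsProbabilityMeasure ((gaussianRow (Fin n)).map (· + A i)) :=
    Measure.isProbabilityMeasure_map (by fun_prop)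
  rw [← Measure.pi_map_pi (fun j => by fun_prop), Measure.map_apply (by fun_prop) hT]
  rfl

/-- Scaling up the rows of the deterministic part of the channel decreases the outage
probability. -/
lemma gaussianMatrix_logDet_le_anti (hK : K.PosSemidef) (v : Fin m → Fin n → ℂ) {s t : Fin m → ℝ}
    (hst : ∀ i, |s i| ≤ |t i|) (c : ℝ) :
    gaussianMatrix m n {X | logDet K (of (X + fun i => (t i : ℂ) • v i)) ≤ c} ≤
      gaussianMatrix m n {X | logDet K (of (X + fun i => (s i : ℂ) • v i)) ≤ c} := by
  have hm : MeasurableSet {Y : Fin m → Fin n → ℂ | logDet K (of Y) ≤ c} :=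
    measurableSet_le (measurable_logDet K) measurable_const
  have ht := gaussianMatrix_add_preimage (fun i => (t i : ℂ) • v i) hm
  have hs := gaussianMatrix_add_preimage (fun i => (s i : ℂ) • v i) hm
  rw [Set.preimage_ofPred_eq] at ht hs
  rw [ht, hs]
  have hp (a : Fin n → ℂ) : IsProbabilityMeasure ((gaussianRow (Fin n)).map (· + a)) :=
    Measure.isProbabilityMeasure_map (by fun_prop)
  refine Measure.pi_apply_mono _ _ hm fun i x => ?_
  obtain ⟨δ, hδ, M, hM, -, hdet⟩ := exists_re_det_updateRow hK (of x) i
  have hset : {y | Function.update x i y ∈ {Y : Fin m → Fin n → ℂ | logDet K (of Y) ≤ c}} =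
      {y | (y ⬝ᵥ (M *ᵥ star y)).re ≤ Real.exp c / δ - 1} := by
    ext y
    have := hdet y
    simp only [Set.mem_ofPred_eq]
    rw [logDet_le_iff hK, show of (Function.update x i y) = (of x).updateRow i y from rfl, this,
      ← le_div_iff₀' hδ, le_sub_iff_add_le']
  have hm' : MeasurableSet {y | (y ⬝ᵥ (M *ᵥ star y)).re ≤ Real.exp c / δ - 1} := by
    rw [← hset]
    exact measurable_update x hm
  rw [hset, Measure.map_apply (by fun_prop) hm', Measure.map_apply (by fun_prop) hm']
  exact gaussianRow_quadForm_le_anti hM (v i) (hst i) _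

/-- With all rows but the first frozen, the event is a level set of a nonzero Hermitian form of a
Gaussian vector, hence null. -/
lemma gaussianMatrix_logDet_eq (hK : K.PosSemidef) (hK0 : K ≠ 0) (hm0 : 0 < m)
    (A : Fin m → Fin n → ℂ) (c : ℝ) :
    gaussianMatrix m n {X | logDet K (of (X + A)) = c} = 0 := by
  have hm : MeasurableSet {X : Fin m → Fin n → ℂ | logDet K (of (X + A)) = c} :=
    measurableSet_eq_fun ((measurable_logDet K).comp (by fun_prop)) measurable_const
  let i : Fin m := ⟨0, hm0⟩
  refine Measure.pi_apply_eq_zero_of_slices _ hm i fun x => ?_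
  obtain ⟨δ, hδ, M, hM, hM0, hdet⟩ := exists_re_det_updateRow hK (of (x + A)) i
  convert gaussianRow_quadForm_eq hM.1 (hM0 hK0) (A i) (Real.exp c / δ - 1) using 2
  ext y
  have hupd : of (Function.update x i y + A) = (of (x + A)).updateRow i (y + A i) := by
    ext k l
    rcases eq_or_ne k i with rfl | hk
    · simp
    · simp [Matrix.updateRow_ne hk, Function.update_of_ne hk]
  simp only [Set.mem_ofPred_eq]
  rw [logDet_eq_iff hK, hupd, hdet, eq_sub_iff_add_eq', eq_div_iff hδ.ne', mul_comm]

end LogDet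

end RicianMIMO

namespace RicianMIMO

open Matrix

/-! ### From the random matrix to its law. -/

section Law

variable {Ω : Type*} [MeasurableSpace Ω] {P : Measure Ω} {m n : ℕ}
  {H : Ω → Matrix (Fin m) (Fin n) ℂ}

lemma IsStdGaussianMatrix.aemeasurable (hH : IsStdGaussianMatrix H P) :
    AEMeasurable (fun ω => of.symm (H ω)) P :=
  aemeasurable_pi_lambda _ fun i => aemeasurable_pi_lambda _ fun j => (hH.hasLaw i j).aemeasurable

variable [IsProbabilityMeasure P]

lemma IsStdGaussianMatrix.map_eq (hH : IsStdGaussianMatrix H P) :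
    P.map (fun ω => of.symm (H ω)) = gaussianMatrix m n := by
  have hm (p : Fin m × Fin n) : AEMeasurable (fun ω => H ω p.1 p.2) P :=
    (hH.hasLaw p.1 p.2).aemeasurable
  have h := (iIndepFun_iff_map_fun_eq_pi_map hm).1 hH.indep
  simp_rw [(hH.hasLaw _ _).map_eq] at h
  have hc : Measurable (Function.curry : (Fin m × Fin n → ℂ) → Fin m → Fin n → ℂ) := by
    refine measurable_pi_lambda _ fun i => measurable_pi_lambda _ fun j => ?_
    exact measurable_pi_apply (i, j)
  rw [gaussianMatrix, ← Measure.pi_map_curry, ← h,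
    AEMeasurable.map_map_of_aemeasurable hc.aemeasurable (aemeasurable_pi_lambda _ hm)]
  rfl

lemma measurable_logDet_add (K : Matrix (Fin n) (Fin n) ℂ) (A : Matrix (Fin m) (Fin n) ℂ) :
    Measurable fun X : Fin m → Fin n → ℂ => logDet K (of X + A) :=
  (measurable_logDet K).comp (by fun_prop : Measurable fun X : Fin m → Fin n → ℂ => X + of.symm A)

lemma measurableSet_logDet_le (K : Matrix (Fin n) (Fin n) ℂ) (A : Matrix (Fin m) (Fin n) ℂ) (t : ℝ) :
    MeasurableSet {X : Fin m → Fin n → ℂ | logDet K (of X + A) ≤ t} :=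
  measurableSet_le (measurable_logDet_add K A) measurable_const

lemma IsStdGaussianMatrix.outageProb_eq (hH : IsStdGaussianMatrix H P) (t : ℝ)
    (K : Matrix (Fin n) (Fin n) ℂ) (A : Matrix (Fin m) (Fin n) ℂ) :
    outageProb P H t K A = (gaussianMatrix m n).real {X | logDet K (of X + A) ≤ t} := by
  rw [← hH.map_eq, measureReal_def, Measure.map_apply_of_aemeasurable hH.aemeasurable
    (measurableSet_logDet_le K A t)]
  rfl

lemma IsStdGaussianMatrix.infoRate_eq (hH : IsStdGaussianMatrix H P)
    (K : Matrix (Fin n) (Fin n) ℂ) (A : Matrix (Fin m) (Fin n) ℂ) :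
    infoRate P H K A = ∫ X, logDet K (of X + A) ∂gaussianMatrix m n := by
  rw [← hH.map_eq, integral_map hH.aemeasurable
    (measurable_logDet_add K A).aestronglyMeasurable]
  rfl

end Law

/-! ### Unitary invariance of the channel law. -/

section UnitaryInvariance

variable {m n : ℕ}

lemma sum_norm_sq_eq_trace (X : Matrix (Fin m) (Fin n) ℂ) :
    ((∑ p : Fin m × Fin n, ‖X p.1 p.2‖ ^ 2 : ℝ) : ℂ) = (Xᴴ * X).trace := by
  rw [Fintype.sum_prod_type_right]
  simp [Matrix.trace, Matrix.mul_apply, Complex.conj_mul']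

lemma sum_norm_sq_unitary_mul_mul {U : Matrix (Fin m) (Fin m) ℂ} (hU : U ∈ unitaryGroup (Fin m) ℂ)
    {V : Matrix (Fin n) (Fin n) ℂ} (hV : V ∈ unitaryGroup (Fin n) ℂ)
    (X : Matrix (Fin m) (Fin n) ℂ) :
    ∑ p : Fin m × Fin n, ‖(U * X * V) p.1 p.2‖ ^ 2 = ∑ p : Fin m × Fin n, ‖X p.1 p.2‖ ^ 2 := by
  apply Complex.ofReal_injective
  rw [sum_norm_sq_eq_trace, sum_norm_sq_eq_trace]
  have hU' : Uᴴ * U = 1 := mem_unitaryGroup_iff'.1 hU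
  have hV' : V * Vᴴ = 1 := mem_unitaryGroup_iff.1 hV
  calc ((U * X * V)ᴴ * (U * X * V)).trace = (Vᴴ * (Xᴴ * (Uᴴ * U) * X * V)).trace := by
        simp only [conjTranspose_mul, Matrix.mul_assoc]
    _ = (Xᴴ * X).trace := by
        rw [hU', Matrix.mul_one, Matrix.trace_mul_comm, Matrix.mul_assoc, hV', Matrix.mul_one]

/-- Flattened to one vector of `m * n` independent entries, the map preserves the Frobenius norm, so
`pi_stdComplexGaussian_map` applies. -/
lemma gaussianMatrix_map_unitary {U : Matrix (Fin m) (Fin m) ℂ}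
    (hU : U ∈ unitaryGroup (Fin m) ℂ) {V : Matrix (Fin n) (Fin n) ℂ}
    (hV : V ∈ unitaryGroup (Fin n) ℂ) :
    (gaussianMatrix m n).map (fun X => of.symm (U * of X * V)) =
      gaussianMatrix m n := by
  let f : (Fin m × Fin n → ℂ) →ₗ[ℂ] (Fin m × Fin n → ℂ) :=
    { toFun := fun x p => (U * of (Function.curry x) * V) p.1 p.2
      map_add' := fun x y => by
        have : of (Function.curry (x + y)) = of (Function.curry x) + of (Function.curry y) := rfl
        ext p
        rw [this, Matrix.mul_add, Matrix.add_mul]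
        rfl
      map_smul' := fun c x => by
        have : of (Function.curry (c • x)) = c • of (Function.curry x) := rfl
        ext p
        rw [this, Matrix.mul_smul, Matrix.smul_mul]
        rfl }
  have hf := pi_stdComplexGaussian_map f fun x =>
    sum_norm_sq_unitary_mul_mul hU hV (of (Function.curry x))
  have hfm : Measurable f := (LinearMap.continuous_of_finiteDimensional f).measurable
  have hc : Measurable (Function.curry : (Fin m × Fin n → ℂ) → Fin m → Fin n → ℂ) := by
    refine measurable_pi_lambda _ fun i => measurable_pi_lambda _ fun j => ?_
    exact measurable_pi_apply (i, j)
  have hg : Measurable fun X : Fin m → Fin n → ℂ => of.symm (U * of X * V) := by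
    refine Continuous.measurable ?_
    have : Continuous fun G : Fin m → Fin n → ℂ => (of G : Matrix (Fin m) (Fin n) ℂ) :=
      continuous_id
    exact (continuous_const.matrix_mul this).matrix_mul continuous_const
  rw [gaussianMatrix, ← Measure.pi_map_curry]
  conv_rhs => rw [← hf, Measure.map_map hc hfm]
  exact Measure.map_map hg hc

lemma logDet_unitary_mul_mul {U : Matrix (Fin m) (Fin m) ℂ} (hU : U ∈ unitaryGroup (Fin m) ℂ)
    (K V : Matrix (Fin n) (Fin n) ℂ) (G : Matrix (Fin m) (Fin n) ℂ) :
    logDet K (U * G * V) = logDet (V * K * Vᴴ) G := by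
  have hU' : U * Uᴴ = 1 := mem_unitaryGroup_iff.1 hU
  have h : 1 + U * G * V * K * (U * G * V)ᴴ = U * (1 + G * (V * K * Vᴴ) * Gᴴ) * Uᴴ := by
    simp only [conjTranspose_mul, Matrix.mul_add, Matrix.add_mul, Matrix.mul_one, hU',
      Matrix.mul_assoc]
  rw [logDet, logDet, h, Matrix.det_mul_right_comm, hU', one_mul]

lemma gaussianMatrix_logDet_le_unitary {U : Matrix (Fin m) (Fin m) ℂ}
    (hU : U ∈ unitaryGroup (Fin m) ℂ) {V : Matrix (Fin n) (Fin n) ℂ}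
    (hV : V ∈ unitaryGroup (Fin n) ℂ) (K : Matrix (Fin n) (Fin n) ℂ)
    (A : Matrix (Fin m) (Fin n) ℂ) (t : ℝ) :
    gaussianMatrix m n {X | logDet K (of X + U * A * V) ≤ t} =
      gaussianMatrix m n {X | logDet (V * K * Vᴴ) (of X + A) ≤ t} := by
  have hg : Measurable fun X : Fin m → Fin n → ℂ => of.symm (U * of X * V) := by
    refine Continuous.measurable ?_
    have : Continuous fun G : Fin m → Fin n → ℂ => (of G : Matrix (Fin m) (Fin n) ℂ) :=
      continuous_id
    exact (continuous_const.matrix_mul this).matrix_mul continuous_const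
  conv_lhs => rw [← gaussianMatrix_map_unitary hU hV]
  refine (Measure.map_apply hg (measurableSet_logDet_le K _ t)).trans ?_
  congr 1
  ext X
  have : of (of.symm (U * of X * V)) + U * A * V = U * (of X + A) * V := by
    rw [Equiv.apply_symm_apply, Matrix.mul_add, Matrix.add_mul]
  simp only [Set.mem_preimage, Set.mem_ofPred_eq]
  rw [this, logDet_unitary_mul_mul hU]

end UnitaryInvariance

/-! ### Singular value decomposition and reduction to diagonal matrices. -/

section SingularValues

variable {m n : ℕ}

/-- The `m × n` matrix with `σ` on its diagonal. -/
def rectDiagonal (m n : ℕ) (σ : ℕ → ℝ) : Matrix (Fin m) (Fin n) ℂ :=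
  of fun i j => if (i : ℕ) = j then (σ i : ℂ) else 0

lemma mem_unitaryGroup_of_orthonormalBasis {k : ℕ}
    (b : OrthonormalBasis (Fin k) ℂ (EuclideanSpace ℂ (Fin k))) :
    (of fun i j => b j i) ∈ unitaryGroup (Fin k) ℂ := by
  rw [mem_unitaryGroup_iff']
  ext i j
  have h := orthonormal_iff_ite.1 b.orthonormal i j
  rw [PiLp.inner_apply] at h
  rw [Matrix.one_apply, ← h]
  simp [Matrix.mul_apply, Matrix.star_apply, mul_comm]

/-- The singular value decomposition. -/
lemma exists_singularValue_decomposition (D : Matrix (Fin m) (Fin n) ℂ) :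
    ∃ U ∈ unitaryGroup (Fin m) ℂ, ∃ V ∈ unitaryGroup (Fin n) ℂ,
      D = U * rectDiagonal m n (singularValue D) * V := by
  set T := Matrix.toEuclideanLin D with hT
  have hn : Module.finrank ℂ (EuclideanSpace ℂ (Fin n)) = n := by simp
  set b := T.isSymmetric_adjoint_comp_self.eigenvectorBasis hn with hb
  have hinner (i j : Fin n) : inner ℂ (T (b i)) (T (b j)) =
      if i = j then ((singularValue D j : ℂ)) ^ 2 else 0 := by
    have h1 : (T.adjoint ∘ₗ T) (b j) = ((singularValue D j : ℂ)) ^ 2 • b j := by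
      rw [hb, LinearMap.IsSymmetric.apply_eigenvectorBasis, ← T.sq_singularValues_fin hn j]
      simp [singularValue, hT]
    rw [← LinearMap.adjoint_inner_right, ← LinearMap.comp_apply, h1, inner_smul_right,
      orthonormal_iff_ite.1 b.orthonormal]
    simp
  have hzero (j : Fin n) (h : singularValue D j = 0) : T (b j) = 0 := by
    rw [← inner_self_eq_zero (𝕜 := ℂ), hinner, if_pos rfl, h]
    simp
  have hlarge (j : ℕ) (h : m ≤ j) : singularValue D j = 0 := by
    refine T.singularValues_eq_zero_iff_le_finrank_range.2 (le_trans ?_ h)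
    simpa using T.range.finrank_le
  -- The left singular vectors are normalised images of the right ones. Only indices in `s` below
  -- matter; on the others the values are placeholders, replaced when the family is completed to an
  -- orthonormal basis.
  let v : Fin m → EuclideanSpace ℂ (Fin m) := fun i =>
    if h : (i : ℕ) < n then ((singularValue D i : ℂ))⁻¹ • T (b ⟨i, h⟩) else 0
  let s : Set (Fin m) := {i | (i : ℕ) < n ∧ singularValue D i ≠ 0}
  have hv : Orthonormal ℂ (s.domRestrict v) := by
    rw [orthonormal_iff_ite]
    rintro ⟨i, hi⟩ ⟨j, hj⟩
    change inner ℂ (v i) (v j) = _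
    simp only [v, dif_pos hi.1, dif_pos hj.1, inner_smul_left,
      inner_smul_right, hinner, Subtype.mk.injEq, Fin.ext_iff]
    split_ifs with hij
    · have hj0 : (singularValue D j : ℂ) ≠ 0 := Complex.ofReal_ne_zero.2 hj.2
      rw [hij]
      simp only [map_inv₀, Complex.conj_ofReal]
      field_simp
    · simp
  obtain ⟨u, hu⟩ := hv.exists_orthonormalBasis_extension_of_card_eq (by simp)
  have hTb (j : Fin n) (h : (j : ℕ) < m) : T (b j) = (singularValue D j : ℂ) • u ⟨j, h⟩ := by
    by_cases h0 : singularValue D j = 0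
    · rw [hzero j h0, h0]; simp
    · have hj : (⟨j, h⟩ : Fin m) ∈ s := ⟨j.2, h0⟩
      rw [hu _ hj]
      simp only [v, dif_pos j.2]
      rw [smul_smul, mul_inv_cancel₀ (Complex.ofReal_ne_zero.2 h0), one_smul]
  set U : Matrix (Fin m) (Fin m) ℂ := of fun i j => u j i
  set V : Matrix (Fin n) (Fin n) ℂ := of fun i j => b j i
  have hV : V ∈ unitaryGroup (Fin n) ℂ := mem_unitaryGroup_of_orthonormalBasis b
  refine ⟨U, mem_unitaryGroup_of_orthonormalBasis u, star V, Unitary.star_mem hV, ?_⟩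
  have hDV : D * V = U * rectDiagonal m n (singularValue D) := by
    ext i j
    have h1 : (D * V) i j = T (b j) i := by
      simp [hT, V, Matrix.mul_apply, Matrix.toLpLin_apply, Matrix.mulVec, dotProduct]
    rw [h1, Matrix.mul_apply]
    by_cases h : (j : ℕ) < m
    · rw [hTb j h, Finset.sum_eq_single ⟨j, h⟩]
      · simp [rectDiagonal, U, mul_comm]
      · intro k _ hk
        have : (k : ℕ) ≠ j := fun hkj => hk (Fin.ext hkj)
        simp [rectDiagonal, this]
      · simp
    · rw [hzero j (hlarge j (not_lt.1 h)), Finset.sum_eq_zero]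
      · simp
      · intro k _
        have : (k : ℕ) ≠ j := by omega
        simp [rectDiagonal, this]
  rw [← hDV, Matrix.mul_assoc, mem_unitaryGroup_iff.1 hV, Matrix.mul_one]

lemma gaussianMatrix_logDet_rectDiagonal_anti {K : Matrix (Fin n) (Fin n) ℂ} (hK : K.PosSemidef)
    {σ τ : ℕ → ℝ} (hσ : ∀ i, 0 ≤ σ i) (hστ : ∀ i < min m n, σ i ≤ τ i) (t : ℝ) :
    gaussianMatrix m n {X | logDet K (of X + rectDiagonal m n τ) ≤ t} ≤
      gaussianMatrix m n {X | logDet K (of X + rectDiagonal m n σ) ≤ t} := by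
  -- Row `i` is a multiple of a direction independent of `ρ`. Rows with `i ≥ n` vanish, and their
  -- coefficient is set to `0` because nothing is assumed on `ρ` there.
  have h (ρ : ℕ → ℝ) : rectDiagonal m n ρ = of fun (i : Fin m) =>
      (((if (i : ℕ) < n then ρ i else 0 : ℝ)) : ℂ) • fun j : Fin n =>
        if (i : ℕ) = j then (1 : ℂ) else 0 := by
    ext i j
    by_cases hij : (i : ℕ) = j
    · simp [rectDiagonal, hij, j.2]
    · by_cases hi : (i : ℕ) < n <;> simp [rectDiagonal, hij, hi]
  rw [h σ, h τ]
  refine gaussianMatrix_logDet_le_anti hK _ (fun i => ?_) t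
  split_ifs with hi
  · exact abs_le_abs_of_nonneg (hσ i) (hστ i (lt_min i.2 hi))
  · rfl

/-- If the singular values of `D` dominate those of `D'`, then up to a unitary change of the input
covariance, every outage probability for `D` is at most the one for `D'`. -/
lemma exists_unitary_logDet_le_anti {D D' : Matrix (Fin m) (Fin n) ℂ}
    (hσ : ∀ i < min m n, singularValue D' i ≤ singularValue D i) :
    ∃ W ∈ unitaryGroup (Fin n) ℂ, ∀ K : Matrix (Fin n) (Fin n) ℂ, K.PosSemidef → ∀ t : ℝ,
      gaussianMatrix m n {X | logDet (W * K * Wᴴ) (of X + D) ≤ t} ≤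
        gaussianMatrix m n {X | logDet K (of X + D') ≤ t} := by
  obtain ⟨U, hU, V, hV, hD⟩ := exists_singularValue_decomposition D
  obtain ⟨U', hU', V', hV', hD'⟩ := exists_singularValue_decomposition D'
  -- This unitary is chosen so that, once both matrices are diagonalised, the two sides carry the
  -- same covariance `V' K V'ᴴ`.
  refine ⟨star V * V', mul_mem (Unitary.star_mem hV) hV', fun K hK t => ?_⟩
  have hVV : V * star V = 1 := mem_unitaryGroup_iff.1 hV
  have hK' : V * (star V * V' * K * (star V * V')ᴴ) * Vᴴ = V' * K * V'ᴴ := by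
    calc V * (star V * V' * K * (star V * V')ᴴ) * Vᴴ
        = (V * star V) * V' * K * V'ᴴ * (V * star V) := by
          simp only [conjTranspose_mul, star_eq_conjTranspose, conjTranspose_conjTranspose,
            Matrix.mul_assoc]
      _ = V' * K * V'ᴴ := by rw [hVV, Matrix.one_mul, Matrix.mul_one]
  have h1 := gaussianMatrix_logDet_le_unitary hU hV (star V * V' * K * (star V * V')ᴴ)
    (rectDiagonal m n (singularValue D)) t
  have h2 := gaussianMatrix_logDet_le_unitary hU' hV' K (rectDiagonal m n (singularValue D')) t
  rw [← hD, hK'] at h1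
  rw [← hD'] at h2
  rw [h1, h2]
  exact gaussianMatrix_logDet_rectDiagonal_anti (hK.mul_mul_conjTranspose_same V')
    (fun i => LinearMap.singularValues_nonneg _ i) hσ t

end SingularValues

end RicianMIMO

namespace RicianMIMO

open Matrix Filter Topology

/-! ### Bounds on `logDet` and compactness of the constraint set. -/

section Bounds

variable {m n : ℕ} {K : Matrix (Fin n) (Fin n) ℂ}

lemma trace_re_eq_sum_eigenvalues (hK : K.PosSemidef) :
    K.trace.re = ∑ i, hK.1.eigenvalues i := by
  rw [hK.1.trace_eq_sum_eigenvalues, Complex.re_sum]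
  rfl

lemma dotProduct_mulVec_star_le (hK : K.PosSemidef) (y : Fin n → ℂ) :
    (y ⬝ᵥ (K *ᵥ star y)).re ≤ K.trace.re * ∑ j, ‖y j‖ ^ 2 := by
  rw [dotProduct_mulVec_star_eq_sum hK.1, trace_re_eq_sum_eigenvalues hK, Finset.sum_mul,
    ← sum_norm_vecMul_sq_of_mem_unitaryGroup hK.1.eigenvectorUnitary.2 y]
  refine Finset.sum_le_sum fun i _ => mul_le_mul_of_nonneg_left ?_ (hK.eigenvalues_nonneg i)
  rw [Complex.normSq_eq_norm_sq]
  exact Finset.single_le_sum (f := fun j =>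
    ‖(y ᵥ* (hK.1.eigenvectorUnitary : Matrix (Fin n) (Fin n) ℂ)) j‖ ^ 2)
    (fun _ _ => by positivity) (Finset.mem_univ i)

lemma logDet_le_trace_mul (hK : K.PosSemidef) (G : Matrix (Fin m) (Fin n) ℂ) :
    logDet K G ≤ K.trace.re * ∑ i, ∑ j, ‖G i j‖ ^ 2 := by
  refine (log_re_det_one_add_le_trace (hK.mul_mul_conjTranspose_same G)).trans ?_
  rw [Matrix.trace, Complex.re_sum, Finset.mul_sum]
  refine Finset.sum_le_sum fun i _ => ?_
  have h : (G * K * Gᴴ).diag i = G i ⬝ᵥ (K *ᵥ star (G i)) := by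
    rw [Matrix.mul_assoc]
    rfl
  rw [h]
  exact dotProduct_mulVec_star_le hK (G i)

/-- Expand in an eigenbasis: entries of a unitary matrix have modulus at most one. This bounds the
constraint set. -/
lemma norm_apply_le_trace (hK : K.PosSemidef) (i j : Fin n) : ‖K i j‖ ≤ K.trace.re := by
  set W := (hK.1.eigenvectorUnitary : Matrix (Fin n) (Fin n) ℂ)
  have h : K = W * Matrix.diagonal (RCLike.ofReal ∘ hK.1.eigenvalues) * Wᴴ := by
    conv_lhs => rw [hK.1.spectral_theorem]
    rfl
  have hW (k l : Fin n) : ‖W k l‖ ≤ 1 := entry_norm_bound_of_unitary hK.1.eigenvectorUnitary.2 k l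
  have hij : K i j = ∑ k, W i k * (hK.1.eigenvalues k : ℂ) * star (W j k) := by
    conv_lhs => rw [h, Matrix.mul_apply]
    refine Finset.sum_congr rfl fun k _ => ?_
    rw [Matrix.mul_diagonal]
    rfl
  rw [trace_re_eq_sum_eigenvalues hK, hij]
  refine (norm_sum_le _ _).trans (Finset.sum_le_sum fun k _ => ?_)
  rw [norm_mul, norm_mul, norm_star, Complex.norm_real, Real.norm_of_nonneg
    (hK.eigenvalues_nonneg k)]
  have h0 := hK.eigenvalues_nonneg k
  calc ‖W i k‖ * hK.1.eigenvalues k * ‖W j k‖ ≤ 1 * hK.1.eigenvalues k * 1 := by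
        gcongr
        · exact hW i k
        · exact hW j k
    _ = _ := by ring

lemma isCompact_inputCovariances (n : ℕ) (E : ℝ) : IsCompact (inputCovariances n E) := by
  have hB : IsCompact {K : Matrix (Fin n) (Fin n) ℂ | ∀ i j, K i j ∈ Metric.closedBall (0 : ℂ) E} := by
    have := isCompact_univ_pi fun _ : Fin n => isCompact_univ_pi fun _ : Fin n =>
      isCompact_closedBall (0 : ℂ) E
    have hset : {K : Fin n → Fin n → ℂ | ∀ i j, K i j ∈ Metric.closedBall (0 : ℂ) E} =
        Set.univ.pi fun _ => Set.univ.pi fun _ => Metric.closedBall (0 : ℂ) E := by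
      ext K
      simp
    rw [← hset] at this
    exact this
  refine hB.of_isClosed_subset ?_ fun K hK i j => ?_
  · have h1 : inputCovariances n E = {K | Kᴴ = K} ∩
        (⋂ x : Fin n → ℂ, {K | 0 ≤ star x ⬝ᵥ (K *ᵥ x)}) ∩ {K | K.trace.re ≤ E} := by
      ext K
      simp [inputCovariances, posSemidef_iff_dotProduct_mulVec, Matrix.IsHermitian]
    rw [h1]
    refine (IsClosed.inter (isClosed_eq (by fun_prop) (by fun_prop))
      (isClosed_iInter fun x => ?_)).inter ?_
    · exact isClosed_le continuous_const (by fun_prop)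
    · exact isClosed_le (by fun_prop) continuous_const
  · rw [mem_closedBall_zero_iff]
    exact (norm_apply_le_trace hK.1 i j).trans hK.2

lemma continuousWithinAt_logDet (E : ℝ) (hK : K ∈ inputCovariances n E)
    (G : Matrix (Fin m) (Fin n) ℂ) :
    ContinuousWithinAt (fun K => logDet K G) (inputCovariances n E) K := by
  refine ContinuousAt.continuousWithinAt (ContinuousAt.log ?_ ?_)
  · fun_prop
  · have := one_le_re_det hK.1 G
    linarith

lemma zero_mem_inputCovariances {E : ℝ} (hE : 0 ≤ E) :
    (0 : Matrix (Fin n) (Fin n) ℂ) ∈ inputCovariances n E :=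
  ⟨PosSemidef.zero, by simpa⟩

@[simp] lemma logDet_zero (G : Matrix (Fin m) (Fin n) ℂ) : logDet 0 G = 0 := by
  simp [logDet]

end Bounds

/-! ### Integrability, continuity in `K` and existence of optimisers. -/

section Existence

variable {m n : ℕ}

lemma integrable_sum_norm_sq (A : Matrix (Fin m) (Fin n) ℂ) :
    Integrable (fun X : Fin m → Fin n → ℂ => ∑ i, ∑ j, ‖(of X + A) i j‖ ^ 2)
      (gaussianMatrix m n) := by
  refine integrable_finsetSum _ fun i _ => integrable_finsetSum _ fun j _ => ?_
  have h1 : Integrable (fun z : ℂ => ‖z + A i j‖ ^ 2) stdComplexGaussian := by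
    refine Integrable.mono' ((integrable_normSq_stdComplexGaussian.const_mul 2).add
      (integrable_const (2 * ‖A i j‖ ^ 2))) (by fun_prop) (Eventually.of_forall fun z => ?_)
    rw [Real.norm_of_nonneg (by positivity)]
    simp only [Pi.add_apply]
    nlinarith [norm_add_le z (A i j), norm_nonneg (z + A i j), sq_nonneg (‖z‖ - ‖A i j‖)]
  have h2 : MeasurePreserving (fun X : Fin m → Fin n → ℂ => X i j) (gaussianMatrix m n)
      stdComplexGaussian :=
    (measurePreserving_eval (fun _ : Fin n => stdComplexGaussian) j).comp
      (measurePreserving_eval (fun _ : Fin m => gaussianRow (Fin n)) i)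
  exact h2.integrable_comp_of_integrable h1

lemma integrable_logDet {K : Matrix (Fin n) (Fin n) ℂ} (hK : K.PosSemidef)
    (A : Matrix (Fin m) (Fin n) ℂ) :
    Integrable (fun X : Fin m → Fin n → ℂ => logDet K (of X + A)) (gaussianMatrix m n) := by
  refine Integrable.mono' ((integrable_sum_norm_sq A).const_mul K.trace.re)
    (measurable_logDet_add K A).aestronglyMeasurable (Eventually.of_forall fun X => ?_)
  rw [Real.norm_of_nonneg (logDet_nonneg hK _)]
  exact logDet_le_trace_mul hK _

instance (n : ℕ) : FirstCountableTopology (Matrix (Fin n) (Fin n) ℂ) :=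
  inferInstanceAs (FirstCountableTopology (Fin n → Fin n → ℂ))

lemma continuousOn_integral_logDet (E : ℝ) (A : Matrix (Fin m) (Fin n) ℂ) :
    ContinuousOn (fun K => ∫ X, logDet K (of X + A) ∂gaussianMatrix m n)
      (inputCovariances n E) := by
  have hb := (integrable_sum_norm_sq A).const_mul E
  refine continuousOn_of_dominated (F := fun K (X : Fin m → Fin n → ℂ) => logDet K (of X + A))
    (bound := fun X : Fin m → Fin n → ℂ => E * ∑ i, ∑ j, ‖(of X + A) i j‖ ^ 2)
    (fun K _ => (measurable_logDet_add K A).aestronglyMeasurable)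
    (fun K hK => Eventually.of_forall fun X => ?_) hb
    (Eventually.of_forall fun X => ?_)
  swap
  · intro K hK
    exact continuousWithinAt_logDet E hK (of X + A)
  rw [Real.norm_of_nonneg (logDet_nonneg hK.1 _)]
  refine (logDet_le_trace_mul hK.1 _).trans ?_
  exact mul_le_mul_of_nonneg_right hK.2 (by positivity)

lemma gaussianMatrix_logDet_eq_of_pos {K : Matrix (Fin n) (Fin n) ℂ} (hK : K.PosSemidef)
    (A : Matrix (Fin m) (Fin n) ℂ) {R : ℝ} (hR : 0 < R) :
    gaussianMatrix m n {X | logDet K (of X + A) = R} = 0 := by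
  by_cases h : K ≠ 0 ∧ 0 < m
  · exact gaussianMatrix_logDet_eq hK h.1 h.2 (of.symm A) R
  · have h0 (G : Matrix (Fin m) (Fin n) ℂ) : logDet K G ≠ R := by
      rw [not_and_or, not_not, not_lt, Nat.le_zero] at h
      rcases h with rfl | rfl
      · rw [logDet_zero]; exact hR.ne
      · simp [logDet, hR.ne]
    simp [h0]

/-- The indicator of `Iic R` is discontinuous only at `R`, a level reached with probability zero, so
dominated convergence applies. Positivity of `R` excludes the atom at `0` that occurs for `K = 0`.
-/
lemma continuousOn_measureReal_logDet_le (E : ℝ) (A : Matrix (Fin m) (Fin n) ℂ) {R : ℝ}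
    (hR : 0 < R) :
    ContinuousOn (fun K => (gaussianMatrix m n).real {X | logDet K (of X + A) ≤ R})
      (inputCovariances n E) := by
  intro K hK
  have h (K : Matrix (Fin n) (Fin n) ℂ) :
      (gaussianMatrix m n).real {X | logDet K (of X + A) ≤ R} =
        ∫ X, (Set.Iic R).indicator (fun _ => (1 : ℝ)) (logDet K (of X + A)) ∂gaussianMatrix m n := by
    rw [← integral_indicator_one (measurableSet_logDet_le K A R)]
    rfl
  simp_rw [h]
  refine continuousWithinAt_of_dominated (bound := fun _ => 1)
    (Eventually.of_forall fun K => ?_) (Eventually.of_forall fun K => Eventually.of_forall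
      fun X => ?_) (integrable_const 1) ?_
  · exact ((measurable_const.indicator measurableSet_Iic).comp
      (measurable_logDet_add K A)).aestronglyMeasurable
  · by_cases hX : logDet K (of X + A) ∈ Set.Iic R <;> simp [hX]
  · have hne : ∀ᵐ X ∂gaussianMatrix m n, logDet K (of X + A) ≠ R :=
      ae_iff.2 (by simpa using gaussianMatrix_logDet_eq_of_pos hK.1 A hR)
    filter_upwards [hne] with X hX
    have hc := continuousWithinAt_logDet E hK (of X + A)
    refine ContinuousAt.comp_continuousWithinAt (f := fun K => logDet K (of X + A))
      (g := (Set.Iic R).indicator fun _ => (1 : ℝ)) ?_ hc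
    rcases hX.lt_or_gt with hlt | hgt
    · refine (continuousAt_const (y := (1 : ℝ))).congr ?_
      filter_upwards [Iio_mem_nhds hlt] with x hx
      rw [Set.indicator_of_mem (Set.mem_Iic.2 (le_of_lt hx))]
    · refine (continuousAt_const (y := (0 : ℝ))).congr ?_
      filter_upwards [Ioi_mem_nhds hgt] with x hx
      rw [Set.indicator_of_notMem (by simpa using hx)]

lemma exists_isMinOn_measureReal_logDet_le {E R : ℝ} (hE : 0 ≤ E) (hR : 0 ≤ R)
    (A : Matrix (Fin m) (Fin n) ℂ) :
    ∃ K ∈ inputCovariances n E,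
      IsMinOn (fun K => (gaussianMatrix m n).real {X | logDet K (of X + A) ≤ R})
        (inputCovariances n E) K := by
  rcases hR.eq_or_lt with rfl | hR
  -- At `R = 0` continuity can fail at `K = 0`. If `m > 0`, any nonzero admissible `K` has outage
  -- probability zero; with no such `K`, or with `m = 0`, `logDet` vanishes for every admissible
  -- `K`.
  · by_cases h : ∃ K ∈ inputCovariances n E, K ≠ 0 ∧ 0 < m
    · obtain ⟨K, hK, hK0, hm⟩ := h
      refine ⟨K, hK, fun K' _ => ?_⟩
      have hset : {X : Fin m → Fin n → ℂ | logDet K (of X + A) ≤ 0} =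
          {X | logDet K (of X + A) = 0} := by
        ext X
        exact ⟨fun h => le_antisymm h (logDet_nonneg hK.1 _), fun h => h.le⟩
      have hzero : (gaussianMatrix m n).real {X | logDet K (of X + A) ≤ 0} = 0 := by
        rw [hset, measureReal_def]
        have := gaussianMatrix_logDet_eq hK.1 hK0 hm (of.symm A) 0
        exact (ENNReal.toReal_eq_zero_iff _).2 (Or.inl this)
      simp only [Set.mem_ofPred_eq, hzero]
      exact measureReal_nonneg
    · refine ⟨0, zero_mem_inputCovariances hE, fun K hK => ?_⟩
      have h0 (G : Matrix (Fin m) (Fin n) ℂ) : logDet K G = 0 := by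
        have hK' : ¬(K ≠ 0 ∧ 0 < m) := fun hc => h ⟨K, hK, hc⟩
        rw [not_and_or, not_not, not_lt, Nat.le_zero] at hK'
        rcases hK' with rfl | rfl
        · exact logDet_zero G
        · simp [logDet]
      simp [h0]
  · exact (isCompact_inputCovariances n E).exists_isMinOn ⟨0, zero_mem_inputCovariances hE⟩
      (continuousOn_measureReal_logDet_le E A hR)

end Existence

/-! ### From distribution functions to rates, and unitary transport of covariances. -/

section Comparison

variable {m n : ℕ}

/-- Pointwise comparison of outage probabilities gives a comparison of information rates. -/
lemma integral_logDet_le_of_measure_le {K K' : Matrix (Fin n) (Fin n) ℂ} (hK : K.PosSemidef)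
    (hK' : K'.PosSemidef) {A A' : Matrix (Fin m) (Fin n) ℂ}
    (h : ∀ t : ℝ, gaussianMatrix m n {X | logDet K (of X + A) ≤ t} ≤
      gaussianMatrix m n {X | logDet K' (of X + A') ≤ t}) :
    ∫ X, logDet K' (of X + A') ∂gaussianMatrix m n ≤
      ∫ X, logDet K (of X + A) ∂gaussianMatrix m n := by
  have hnn {L : Matrix (Fin n) (Fin n) ℂ} (hL : L.PosSemidef) (B : Matrix (Fin m) (Fin n) ℂ) :
      0 ≤ᵐ[gaussianMatrix m n] fun X => logDet L (of X + B) :=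
    Eventually.of_forall fun X => logDet_nonneg hL _
  have hcompl (L : Matrix (Fin n) (Fin n) ℂ) (B : Matrix (Fin m) (Fin n) ℂ) (t : ℝ) :
      gaussianMatrix m n {X | t < logDet L (of X + B)} =
        1 - gaussianMatrix m n {X | logDet L (of X + B) ≤ t} := by
    rw [← prob_compl_eq_one_sub (measurableSet_logDet_le L B t)]
    congr 1
    ext X
    simp
  -- Layer cake: the mean of a nonnegative variable is the integral of its tail probabilities.
  rw [← ENNReal.ofReal_le_ofReal_iff (integral_nonneg_of_ae (hnn hK A)),
    ofReal_integral_eq_lintegral_ofReal (integrable_logDet hK' A') (hnn hK' A'),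
    ofReal_integral_eq_lintegral_ofReal (integrable_logDet hK A) (hnn hK A),
    lintegral_eq_lintegral_meas_lt _ (hnn hK' A') (measurable_logDet_add K' A').aemeasurable,
    lintegral_eq_lintegral_meas_lt _ (hnn hK A) (measurable_logDet_add K A).aemeasurable]
  refine lintegral_mono fun t => ?_
  rw [hcompl, hcompl]
  exact tsub_le_tsub_left (h t) 1

lemma unitary_mul_mem_inputCovariances {W : Matrix (Fin n) (Fin n) ℂ}
    (hW : W ∈ unitaryGroup (Fin n) ℂ) {E : ℝ} {K : Matrix (Fin n) (Fin n) ℂ}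
    (hK : K ∈ inputCovariances n E) : W * K * Wᴴ ∈ inputCovariances n E := by
  refine ⟨hK.1.mul_mul_conjTranspose_same W, ?_⟩
  rw [Matrix.trace_mul_cycle, ← star_eq_conjTranspose, mem_unitaryGroup_iff'.1 hW, Matrix.one_mul]
  exact hK.2

lemma unitary_mul_isotropicCov {W : Matrix (Fin n) (Fin n) ℂ}
    (hW : W ∈ unitaryGroup (Fin n) ℂ) (E : ℝ) :
    W * isotropicCov n E * Wᴴ = isotropicCov n E := by
  rw [isotropicCov, Matrix.mul_smul, Matrix.mul_one, Matrix.smul_mul, ← star_eq_conjTranspose,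
    mem_unitaryGroup_iff.1 hW]

lemma posSemidef_isotropicCov {E : ℝ} (hE : 0 ≤ E) : (isotropicCov n E).PosSemidef :=
  PosSemidef.one.smul (by
    rw [Complex.zero_le_real]
    positivity)

end Comparison

end RicianMIMO
-- The main theorem.
theorem corollary2 {Ω : Type*} [MeasurableSpace Ω] (P : Measure Ω) [IsProbabilityMeasure P]
    {m n : ℕ} (H : Ω → Matrix (Fin m) (Fin n) ℂ) (hH : IsStdGaussianMatrix H P)
    (D D' : Matrix (Fin m) (Fin n) ℂ)
    (hσ : ∀ i < min m n, singularValue D' i ≤ singularValue D i)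
    (E R : ℝ) (hE : 0 ≤ E) (hR : 0 ≤ R) :
    -- the expectations, the maximum and the minimum in the definitions exist
    (∀ A : Matrix (Fin m) (Fin n) ℂ,
      (∀ K : Matrix (Fin n) (Fin n) ℂ, K.PosSemidef →
        Integrable (fun ω => logDet K (H ω + A)) P) ∧
      IsGreatest ((fun K => infoRate P H K A) '' inputCovariances n E) (capacity P H E A) ∧
      IsLeast ((fun K => outageProb P H R K A) '' inputCovariances n E)
        (optimalOutageProb P H R E A)) ∧
    -- the monotonicity
    isotropicInfoRate P H E D' ≤ isotropicInfoRate P H E D ∧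
    capacity P H E D' ≤ capacity P H E D ∧
    isotropicOutageProb P H R E D ≤ isotropicOutageProb P H R E D' ∧
    optimalOutageProb P H R E D ≤ optimalOutageProb P H R E D' := by
  have hgreat (A : Matrix (Fin m) (Fin n) ℂ) :
      IsGreatest ((fun K => infoRate P H K A) '' inputCovariances n E) (capacity P H E A) := by
    obtain ⟨K, hK, hmax⟩ := (isCompact_inputCovariances n E).exists_isMaxOn
      ⟨0, zero_mem_inputCovariances hE⟩ (continuousOn_integral_logDet E A)
    have h : IsGreatest ((fun K => infoRate P H K A) '' inputCovariances n E)
        (infoRate P H K A) := by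
      refine ⟨⟨K, hK, rfl⟩, ?_⟩
      rintro _ ⟨K', hK', rfl⟩
      simp only [hH.infoRate_eq]
      exact hmax hK'
    rw [capacity, h.csSup_eq]
    exact h
  have hleast (A : Matrix (Fin m) (Fin n) ℂ) :
      IsLeast ((fun K => outageProb P H R K A) '' inputCovariances n E)
        (optimalOutageProb P H R E A) := by
    obtain ⟨K, hK, hmin⟩ := exists_isMinOn_measureReal_logDet_le hE hR A
    have h : IsLeast ((fun K => outageProb P H R K A) '' inputCovariances n E)
        (outageProb P H R K A) := by
      refine ⟨⟨K, hK, rfl⟩, ?_⟩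
      rintro _ ⟨K', hK', rfl⟩
      simp only [hH.outageProb_eq]
      exact hmin hK'
    rw [optimalOutageProb, h.csInf_eq]
    exact h
  obtain ⟨W, hW, hle⟩ := exists_unitary_logDet_le_anti hσ
  have hout (K : Matrix (Fin n) (Fin n) ℂ) (hK : K.PosSemidef) :
      outageProb P H R (W * K * W.conjTranspose) D ≤ outageProb P H R K D' := by
    rw [hH.outageProb_eq, hH.outageProb_eq]
    exact ENNReal.toReal_mono (measure_ne_top _ _) (hle K hK R)
  have hinfo (K : Matrix (Fin n) (Fin n) ℂ) (hK : K.PosSemidef) :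
      infoRate P H K D' ≤ infoRate P H (W * K * W.conjTranspose) D := by
    rw [hH.infoRate_eq, hH.infoRate_eq]
    exact integral_logDet_le_of_measure_le (hK.mul_mul_conjTranspose_same W) hK (hle K hK)
  refine ⟨fun A => ⟨fun K hK => ?_, hgreat A, hleast A⟩, ?_, ?_, ?_, ?_⟩
  · have h := integrable_logDet hK A
    rw [← hH.map_eq] at h
    exact h.comp_aemeasurable hH.aemeasurable
  · have h := hinfo _ (posSemidef_isotropicCov hE)
    rwa [unitary_mul_isotropicCov hW] at h
  · obtain ⟨K, hK, hKeq⟩ := (hgreat D').1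
    rw [← hKeq]
    exact (hinfo K hK.1).trans
      ((hgreat D).2 ⟨_, unitary_mul_mem_inputCovariances hW hK, rfl⟩)
  · have h := hout _ (posSemidef_isotropicCov hE)
    rwa [unitary_mul_isotropicCov hW] at h
  · obtain ⟨K, hK, hKeq⟩ := (hleast D').1
    rw [← hKeq]
    exact ((hleast D).2 ⟨_, unitary_mul_mem_inputCovariances hW hK, rfl⟩).trans (hout K hK.1)
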